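/- A finite hypergraph consists of a finite vertex set $V$ and a set of subsets of $V$, called edges. Its chromatic number is the minimum number of colors needed to color $V$ so that no edge is monochromatic. An $(r,l)$-system is a finite hypergraph all of whose edges have exactly $r$ vertices and in which every two distinct edges share fewer than $l$ vertices. Let $m_k(r,l)$ denote the minimum number of edges in an $(r,l)$-system with chromatic number greater than $k$. Theorem. Fix integers $2\le l<r$. Then for all sufficiently large integers $k$ (depending on $r$ and $l$) an $(r,l)$-system with chromatic number greater than $k$ exists, and $$m_k(r,l)<c_{r,l}\,\bigl(k^{r-1}\log k\bigr)^{l/(l-1)},\qquad c_{r,l}=2\left(\frac{100\,(r)_l^2}{l!}\right)^{1/(l-1)}\left(\frac{10(r-1)}{l-1}\right)^{l/(l-1)},$$ where $(r)_l=r(r-1)\cdots(r-l+1)$ and $\log$ is the natural logarithm. -/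

import Mathlib

open Filter

namespace Hypergraph

variable {α : Type*}

/-- Every edge has exactly `r` vertices. -/
def IsUniform (H : Hypergraph α) (r : ℕ) : Prop :=
  ∀ e ∈ H.edgeSet, e.encard = r

/-- An `(r,l)`-system: an `r`-uniform hypergraph in which every two distinct edges share
fewer than `l` vertices. -/
def IsSystem (H : Hypergraph α) (r l : ℕ) : Prop :=
  H.IsUniform r ∧
    ∀ e ∈ H.edgeSet, ∀ f ∈ H.edgeSet, e ≠ f → (e ∩ f).encard < l

/-- The vertex set can be coloured with `n` colours (the numbers `0, …, n - 1`) so that no edge is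
monochromatic. Values of the colouring outside the vertex set play no role. -/
def Colorable (H : Hypergraph α) (n : ℕ) : Prop :=
  ∃ c : α → ℕ, (∀ x ∈ H.vertexSet, c x < n) ∧
    ∀ e ∈ H.edgeSet, ∃ x ∈ e, ∃ y ∈ e, c x ≠ c y

/-- The least number of colours in a colouring without monochromatic edges
(`⊤` if there is no such colouring with finitely many colours). -/
noncomputable def chromaticNumber (H : Hypergraph α) : ℕ∞ :=
  ⨅ n ∈ {n : ℕ | H.Colorable n}, (n : ℕ∞)

end Hypergraph

/-- The set of all numbers of edges of finite `(r,l)`-systems with chromatic number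
greater than `k`; its least element is `m_k(r,l)`. -/
def systemSizes (r l k : ℕ) : Set ℕ :=
  {m | ∃ (α : Type) (H : Hypergraph α), H.vertexSet.Finite ∧ H.IsSystem r l ∧
    (k : ℕ∞) < H.chromaticNumber ∧ H.edgeSet.encard = m}

/-- The constant `c_{r,l}`; here `r.descFactorial l = r (r - 1) ⋯ (r - l + 1)`. -/
noncomputable def systemConst (r l : ℕ) : ℝ :=
  2 * (100 * (r.descFactorial l : ℝ) ^ 2 / (l.factorial : ℝ)) ^ (1 / ((l : ℝ) - 1)) *
    (10 * ((r : ℝ) - 1) / ((l : ℝ) - 1)) ^ ((l : ℝ) / ((l : ℝ) - 1))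

/-!
Build the system greedily on `n = k * s` points: for `T` steps, pick a random `r`-set and keep it if
it meets every earlier edge in fewer than `l` points. If every `s`-set ends up containing an edge,
then no `k`-colouring is proper, since some colour is used on at least `s` points.

Fix an `s`-set `S`. As long as few edges meet `S` in `l` or more points, at most half of the
`r`-subsets of `S` would be rejected, so each step puts an edge into `S` with conditional
probability at least `q = C(s,r) / (2 C(n,r))`; staying independent in this way for `T` steps has
probability at most `exp (-q T)`. On the other hand, if `X` is the number of edges meeting `S` in
`l` or more points, then `2 ^ X` has expectation at most `exp (ρ T)`, where `ρ` bounds the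
probability that a random `r`-set is such an edge, so `X` is unlikely to become large. A union bound
over the `C(n,s)` choices of `S` succeeds for `T` of order `n k^(r-1) log k` provided that `n^(l-1)`
is a large multiple of `k^(r-1) log k`. The choices are derandomised by conditional expectations.
-/

section Greedy

open Finset

variable {α : Type*} {r l : ℕ} {F G : Finset (Finset α)} {S e : Finset α} {q ρ θ : ℝ}

/-- `S` contains no member of `F`: it is an independent set of the hypergraph with edges `F`. -/
def IsIndependent (F : Finset (Finset α)) (S : Finset α) : Prop :=
  ∀ f ∈ F, ¬ f ⊆ S

theorem IsIndependent.anti (hFG : F ⊆ G) (h : IsIndependent G S) : IsIndependent F S :=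
  fun f hf => h f (hFG hf)

variable [DecidableEq α]

/-- The members of `𝒜` meeting `S` in at least `l` points. A set may be added to a packing `F`
exactly when it has no conflicts with `F`. -/
def conflicts (l : ℕ) (𝒜 : Finset (Finset α)) (S : Finset α) : Finset (Finset α) :=
  {f ∈ 𝒜 | l ≤ #(f ∩ S)}

/-- A partial Steiner system: the edge family of an `(r,l)`-system, as a `Finset`. -/
structure IsPacking (r l : ℕ) (F : Finset (Finset α)) : Prop where
  sized : (F : Set (Finset α)).Sized r
  pairwise : (F : Set (Finset α)).Pairwise fun e f => #(e ∩ f) < l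

/-- One step of the greedy construction of a packing: `e` is added unless it has conflicts. -/
def insertCompatible (l : ℕ) (F : Finset (Finset α)) (e : Finset α) : Finset (Finset α) :=
  if conflicts l F e = ∅ then insert e F else F

/-- `S` is independent while having fewer than `θ` conflicts with `F`, so that a random edge still
has a good chance of landing in `S` and being accepted. -/
def IsActive (l : ℕ) (θ : ℝ) (F : Finset (Finset α)) (S : Finset α) : Prop :=
  IsIndependent F S ∧ #(conflicts l F S) < θ

theorem conflicts_eq_empty_iff : conflicts l F S = ∅ ↔ ∀ f ∈ F, #(f ∩ S) < l := by
  simp only [conflicts, filter_eq_empty_iff, not_le]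

theorem conflicts_mono_left (h : F ⊆ G) : conflicts l F S ⊆ conflicts l G S :=
  filter_subset_filter _ h

theorem conflicts_mono_right (h : e ⊆ S) : conflicts l F e ⊆ conflicts l F S :=
  monotone_filter_right _ fun _ _ hf => hf.trans (card_le_card (inter_subset_inter_left h))

theorem card_conflicts_insert_le :
    #(conflicts l (insert e F) S) ≤ #(conflicts l F S) + if l ≤ #(e ∩ S) then 1 else 0 := by
  unfold conflicts
  rw [filter_insert]
  split_ifs
  · exact card_insert_le _ _
  · rfl

theorem subset_insertCompatible : F ⊆ insertCompatible l F e := by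
  unfold insertCompatible
  split_ifs
  · exact subset_insert _ _
  · exact subset_rfl

theorem insertCompatible_subset : insertCompatible l F e ⊆ insert e F := by
  unfold insertCompatible
  split_ifs
  · exact subset_rfl
  · exact subset_insert _ _

theorem card_insertCompatible_le : #(insertCompatible l F e) ≤ #F + 1 :=
  (card_le_card insertCompatible_subset).trans (card_insert_le _ _)

theorem isPacking_empty : IsPacking r l (∅ : Finset (Finset α)) where
  sized := by simp [Set.Sized]
  pairwise := by simp

theorem IsPacking.insertCompatible (hF : IsPacking r l F) (he : #e = r) :
    IsPacking r l (insertCompatible l F e) := by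
  unfold _root_.insertCompatible
  split_ifs with h
  · refine ⟨?_, ?_⟩
    · intro f hf
      rcases mem_insert.1 (mem_coe.1 hf) with rfl | hf
      exacts [he, hF.sized hf]
    · have : Std.Symm fun e f : Finset α => #(e ∩ f) < l :=
        ⟨fun e f hef => by rwa [inter_comm]⟩
      rw [coe_insert, Set.pairwise_insert_of_symm]
      refine ⟨hF.pairwise, fun f hf _ => ?_⟩
      rw [inter_comm]
      exact conflicts_eq_empty_iff.1 h f hf
  · exact hF

theorem IsActive.anti (hFG : F ⊆ G) (h : IsActive l θ G S) : IsActive l θ F S :=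
  ⟨h.1.anti hFG, h.2.trans_le' (by gcongr; exact conflicts_mono_left hFG)⟩

theorem not_isIndependent_insertCompatible (heS : e ⊆ S) (he : conflicts l F e = ∅) :
    ¬ IsIndependent (insertCompatible l F e) S := by
  rw [insertCompatible, if_pos he]
  exact fun h => h e (mem_insert_self e F) heS

theorem card_conflicts_powersetCard_le (hlr : l ≤ r) (T S : Finset α) :
    #(conflicts l (T.powersetCard r) S) ≤ (#S).choose l * (#T - l).choose (r - l) := by
  have hcover : conflicts l (T.powersetCard r) S ⊆
      ((T ∩ S).powersetCard l).biUnion fun A => {e ∈ T.powersetCard r | A ⊆ e} := by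
    intro e he
    obtain ⟨he, hle⟩ := mem_filter.1 he
    obtain ⟨A, hA, hAl⟩ := exists_subset_card_eq hle
    have heT := (mem_powersetCard.1 he).1
    exact mem_biUnion.2 ⟨A, mem_powersetCard.2 ⟨hA.trans (inter_subset_inter_right heT), hAl⟩,
      mem_filter.2 ⟨he, hA.trans inter_subset_left⟩⟩
  have hfiber : ∀ A ∈ (T ∩ S).powersetCard l,
      #{e ∈ T.powersetCard r | A ⊆ e} ≤ (#T - l).choose (r - l) := by
    intro A hA
    obtain ⟨hAT, hAl⟩ := mem_powersetCard.1 hA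
    rw [card_filter_powersetCard_subset A T r (hAT.trans inter_subset_left) (hAl.trans_le hlr), hAl]
  calc #(conflicts l (T.powersetCard r) S)
      ≤ #((T ∩ S).powersetCard l) * (#T - l).choose (r - l) :=
        (card_le_card hcover).trans (card_biUnion_le_card_mul _ _ _ hfiber)
    _ ≤ (#S).choose l * (#T - l).choose (r - l) := by
        rw [card_powersetCard]
        gcongr
        exact inter_subset_right

theorem card_filter_conflicts_nonempty_le (hlr : l ≤ r) (hF : (F : Set (Finset α)).Sized r) :
    #{e ∈ S.powersetCard r | (conflicts l F e).Nonempty} ≤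
      #(conflicts l F S) * (r.choose l * (#S - l).choose (r - l)) := by
  have hcover : {e ∈ S.powersetCard r | (conflicts l F e).Nonempty} ⊆
      (conflicts l F S).biUnion fun f => conflicts l (S.powersetCard r) f := by
    intro e he
    obtain ⟨he, f, hf⟩ := mem_filter.1 he
    refine mem_biUnion.2 ⟨f, conflicts_mono_right (mem_powersetCard.1 he).1 hf,
      mem_filter.2 ⟨he, ?_⟩⟩
    rw [inter_comm]
    exact (mem_filter.1 hf).2
  refine (card_le_card hcover).trans (card_biUnion_le_card_mul _ _ _ fun f hf => ?_)
  rw [← hF (mem_coe.2 (mem_filter.1 hf).1)]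
  exact card_conflicts_powersetCard_le (hlr.trans_eq (hF (mem_filter.1 hf).1).symm) S f

section Potential

variable {t : ℝ}

open Classical in
/-- The contribution of `S` to the potential of the greedy construction after `t` steps. The first
term penalises independence while `S` has few conflicts, the second one penalises many conflicts;
`1 - q` and `1 + ρ` bound the expected factors by which they change in a step. -/
noncomputable def potential (l : ℕ) (q ρ θ t : ℝ) (F : Finset (Finset α)) (S : Finset α) : ℝ :=
  Real.exp (q * t) * (if IsActive l θ F S then 1 else 0) +
    Real.exp (-(ρ * t)) * 2 ^ #(conflicts l F S)

theorem potential_nonneg : 0 ≤ potential l q ρ θ t F S := by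
  unfold potential
  positivity

theorem potential_empty_le : potential l q ρ θ 0 ∅ S ≤ 2 := by
  unfold potential
  split_ifs <;> norm_num [conflicts]

theorem lt_potential_of_isIndependent {c : ℝ} (h : IsIndependent F S)
    (hq : c < Real.exp (q * t)) (hρ : c < Real.exp (θ * Real.log 2 - ρ * t)) :
    c < potential l q ρ θ t F S := by
  unfold potential
  by_cases hθ : #(conflicts l F S) < θ
  · rw [if_pos ⟨h, hθ⟩, mul_one]
    exact hq.trans (lt_add_of_pos_right _ (by positivity))
  · rw [if_neg fun h' => hθ h'.2, mul_zero, zero_add]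
    refine hρ.trans_le ?_
    rw [sub_eq_neg_add, Real.exp_add, mul_comm θ, ← Real.rpow_def_of_pos two_pos,
      ← Real.rpow_natCast]
    gcongr
    · norm_num
    · exact not_lt.1 hθ

variable [Fintype α]

open Classical in
theorem card_filter_isIndependent_add_choose_le (hlr : l ≤ r)
    (hF : (F : Set (Finset α)).Sized r) :
    #{e ∈ (univ : Finset α).powersetCard r | IsIndependent (insertCompatible l F e) S} +
        (#S).choose r ≤
      (Fintype.card α).choose r + #(conflicts l F S) * (r.choose l * (#S - l).choose (r - l)) := by
  set A := {e ∈ (univ : Finset α).powersetCard r | IsIndependent (insertCompatible l F e) S}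
  set B := {e ∈ S.powersetCard r | conflicts l F e = ∅} with hB
  have hdisj : Disjoint A B := disjoint_left.2 fun e heA heB => by
    obtain ⟨heS, he⟩ := mem_filter.1 heB
    exact not_isIndependent_insertCompatible (mem_powersetCard.1 heS).1 he (mem_filter.1 heA).2
  have hAB : #A + #B ≤ (Fintype.card α).choose r := by
    rw [← card_union_of_disjoint hdisj, ← card_univ, ← card_powersetCard]
    exact card_le_card (union_subset (filter_subset _ _)
      ((filter_subset _ _).trans (powersetCard_mono (subset_univ S))))
  have hS : #B + #{e ∈ S.powersetCard r | (conflicts l F e).Nonempty} = (#S).choose r := by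
    simp only [hB, nonempty_iff_ne_empty]
    rw [card_filter_add_card_filter_not, card_powersetCard]
  have := card_filter_conflicts_nonempty_le (S := S) hlr hF
  omega

theorem sum_two_pow_card_conflicts_insertCompatible_le (hlr : l ≤ r) (F : Finset (Finset α))
    (S : Finset α) :
    ∑ e ∈ (univ : Finset α).powersetCard r, 2 ^ #(conflicts l (insertCompatible l F e) S) ≤
      2 ^ #(conflicts l F S) * ((Fintype.card α).choose r +
        (#S).choose l * (Fintype.card α - l).choose (r - l)) := by
  have hstep (e : Finset α) : 2 ^ #(conflicts l (insertCompatible l F e) S) ≤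
      2 ^ #(conflicts l F S) * (1 + if l ≤ #(e ∩ S) then 1 else 0) := by
    have hle := (card_le_card (conflicts_mono_left (l := l) (S := S)
      (insertCompatible_subset (l := l) (F := F) (e := e)))).trans card_conflicts_insert_le
    refine (Nat.pow_le_pow_right two_pos hle).trans_eq ?_
    split_ifs
    · rw [pow_succ, one_add_one_eq_two]
    · simp
  refine (sum_le_sum fun e _ => hstep e).trans ?_
  rw [← mul_sum, sum_add_distrib, sum_const, smul_eq_mul, mul_one, card_powersetCard,
    ← card_filter, ← card_univ]
  gcongr
  exact card_conflicts_powersetCard_le hlr univ S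

open Classical in
theorem sum_isActive_insertCompatible_le (hlr : l ≤ r) (hF : (F : Set (Finset α)).Sized r)
    (hq : q * (Fintype.card α).choose r + θ * (r.choose l * (#S - l).choose (r - l)) ≤
      (#S).choose r) :
    ∑ e ∈ (univ : Finset α).powersetCard r,
        (if IsActive l θ (insertCompatible l F e) S then (1 : ℝ) else 0) ≤
      (Fintype.card α).choose r *
        ((1 - q) * if IsActive l θ F S then 1 else 0) := by
  by_cases h : IsActive l θ F S
  · rw [if_pos h, mul_one]
    have hcount : (#{e ∈ (univ : Finset α).powersetCard r |
          IsIndependent (insertCompatible l F e) S} + (#S).choose r : ℝ) ≤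
        (Fintype.card α).choose r +
          #(conflicts l F S) * (r.choose l * (#S - l).choose (r - l)) := by
      exact_mod_cast card_filter_isIndependent_add_choose_le hlr hF
    have hθ : #(conflicts l F S) * (r.choose l * (#S - l).choose (r - l) : ℝ) ≤
        θ * (r.choose l * (#S - l).choose (r - l)) := by
      gcongr
      exact h.2.le
    calc _ ≤ (#{e ∈ (univ : Finset α).powersetCard r |
            IsIndependent (insertCompatible l F e) S} : ℝ) := by
          rw [sum_boole]
          gcongr with e
          exact And.left
      _ ≤ (Fintype.card α).choose r * (1 - q) := by linarith
  · rw [if_neg h, mul_zero, mul_zero]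
    exact (sum_eq_zero fun e _ => if_neg fun h' => h (h'.anti subset_insertCompatible)).le

theorem sum_potential_insertCompatible_le (hlr : l ≤ r) (hF : (F : Set (Finset α)).Sized r)
    (hq : q * (Fintype.card α).choose r + θ * (r.choose l * (#S - l).choose (r - l)) ≤
      (#S).choose r)
    (hρ : ((#S).choose l * (Fintype.card α - l).choose (r - l) : ℝ) ≤
      ρ * (Fintype.card α).choose r) :
    ∑ e ∈ (univ : Finset α).powersetCard r,
        potential l q ρ θ (t + 1) (insertCompatible l F e) S ≤
      (Fintype.card α).choose r * potential l q ρ θ t F S := by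
  classical
  have hconflicts : (∑ e ∈ (univ : Finset α).powersetCard r,
      2 ^ #(conflicts l (insertCompatible l F e) S) : ℝ) ≤
      2 ^ #(conflicts l F S) * ((Fintype.card α).choose r +
        (#S).choose l * (Fintype.card α - l).choose (r - l)) := by
    exact_mod_cast sum_two_pow_card_conflicts_insertCompatible_le hlr F S
  have hexp_q : Real.exp (q * (t + 1)) * (1 - q) ≤ Real.exp (q * t) := by
    calc _ ≤ Real.exp (q * (t + 1)) * Real.exp (-q) := by
          gcongr
          exact Real.one_sub_le_exp_neg q
      _ = Real.exp (q * t) := by rw [← Real.exp_add]; ring_nf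
  have hexp_ρ : Real.exp (-(ρ * (t + 1))) * (1 + ρ) ≤ Real.exp (-(ρ * t)) := by
    calc _ ≤ Real.exp (-(ρ * (t + 1))) * Real.exp ρ := by
          gcongr
          rw [add_comm]
          exact Real.add_one_le_exp ρ
      _ = Real.exp (-(ρ * t)) := by rw [← Real.exp_add]; ring_nf
  simp only [potential]
  rw [sum_add_distrib, ← mul_sum, ← mul_sum, mul_add ((Fintype.card α).choose r : ℝ)]
  refine add_le_add ?_ ?_
  · calc _ ≤ Real.exp (q * (t + 1)) * ((Fintype.card α).choose r *
            ((1 - q) * if IsActive l θ F S then 1 else 0)) := by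
          gcongr
          exact sum_isActive_insertCompatible_le hlr hF hq
      _ = (Fintype.card α).choose r * (Real.exp (q * (t + 1)) * (1 - q) *
            if IsActive l θ F S then 1 else 0) := by ring
      _ ≤ _ := by gcongr
  · calc _ ≤ Real.exp (-(ρ * (t + 1))) * (2 ^ #(conflicts l F S) *
            ((Fintype.card α).choose r + ρ * (Fintype.card α).choose r)) := by
          gcongr
          exact hconflicts.trans (by gcongr)
      _ = (Fintype.card α).choose r *
            (Real.exp (-(ρ * (t + 1))) * (1 + ρ) * 2 ^ #(conflicts l F S)) := by ring
      _ ≤ _ := by gcongr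

end Potential

theorem exists_le_of_sum_step_le {σ ι : Type*} {E : Finset ι} (hE : E.Nonempty)
    {step : σ → ι → σ} {P : ℕ → σ → Prop} {Φ : ℕ → σ → ℝ} {x₀ : σ} (h₀ : P 0 x₀)
    (hP : ∀ t x, P t x → ∀ e ∈ E, P (t + 1) (step x e))
    (hΦ : ∀ t x, P t x → ∑ e ∈ E, Φ (t + 1) (step x e) ≤ #E * Φ t x) (t : ℕ) :
    ∃ x, P t x ∧ Φ t x ≤ Φ 0 x₀ := by
  induction t with
  | zero => exact ⟨x₀, h₀, le_rfl⟩
  | succ t ih =>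
    obtain ⟨x, hx, hle⟩ := ih
    obtain ⟨e, he, hstep⟩ := exists_le_of_sum_le (f := fun e => Φ (t + 1) (step x e))
      (g := fun _ => Φ t x) hE ((hΦ t x hx).trans_eq (by rw [sum_const, nsmul_eq_mul]))
    exact ⟨step x e, hP t x hx e he, hstep.trans hle⟩

theorem exists_isPacking_of_potential_lt [Fintype α] {s T : ℕ} (hlr : l ≤ r)
    (hr : r ≤ Fintype.card α)
    (hq : q * (Fintype.card α).choose r + θ * (r.choose l * (s - l).choose (r - l)) ≤
      s.choose r)
    (hρ : (s.choose l * (Fintype.card α - l).choose (r - l) : ℝ) ≤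
      ρ * (Fintype.card α).choose r)
    (hqT : 2 * ((Fintype.card α).choose s : ℝ) < Real.exp (q * T))
    (hρT : 2 * ((Fintype.card α).choose s : ℝ) < Real.exp (θ * Real.log 2 - ρ * T)) :
    ∃ F : Finset (Finset α), IsPacking r l F ∧ #F ≤ T ∧
      ∀ S : Finset α, #S = s → ¬ IsIndependent F S := by
  obtain ⟨F, ⟨hF, hFT⟩, hpot⟩ := exists_le_of_sum_step_le
    (E := (univ : Finset α).powersetCard r) (powersetCard_nonempty.2 (by rwa [card_univ]))
    (step := insertCompatible l) (P := fun t F => IsPacking r l F ∧ #F ≤ t)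
    (Φ := fun t F => ∑ S ∈ (univ : Finset α).powersetCard s, potential l q ρ θ t F S)
    (x₀ := ∅) ⟨isPacking_empty, card_empty.le⟩
    (fun t F hF e he => ⟨hF.1.insertCompatible (mem_powersetCard.1 he).2,
      card_insertCompatible_le.trans (Nat.succ_le_succ hF.2)⟩)
    (fun t F hF => by
      rw [sum_comm, mul_sum, card_powersetCard, card_univ]
      refine sum_le_sum fun S hS => ?_
      obtain rfl := (mem_powersetCard.1 hS).2
      rw [Nat.cast_succ]
      exact sum_potential_insertCompatible_le hlr hF.1.sized hq hρ) T
  refine ⟨F, hF, hFT, fun S hS hind =>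
    (lt_potential_of_isIndependent (l := l) hind hqT hρT).not_ge ?_⟩
  calc potential l q ρ θ T F S
      ≤ ∑ S ∈ (univ : Finset α).powersetCard s, potential l q ρ θ T F S :=
        single_le_sum (f := potential l q ρ θ T F) (fun _ _ => potential_nonneg)
          (mem_powersetCard.2 ⟨subset_univ S, hS⟩)
    _ ≤ ∑ S ∈ (univ : Finset α).powersetCard s, potential l q ρ θ (0 : ℕ) ∅ S := hpot
    _ ≤ ∑ _S ∈ (univ : Finset α).powersetCard s, 2 := by
        rw [Nat.cast_zero]
        exact sum_le_sum fun S _ => potential_empty_le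
    _ = 2 * (Fintype.card α).choose s := by
        rw [sum_const, card_powersetCard, card_univ, nsmul_eq_mul, mul_comm]

theorem exists_isPacking_of_two_mul_choose_lt_exp [Fintype α] {s T : ℕ} (hlr : l ≤ r)
    (hr : r ≤ Fintype.card α)
    (hq : 2 * ((Fintype.card α).choose s : ℝ) <
      Real.exp (s.choose r / (2 * (Fintype.card α).choose r) * T))
    (hρ : 2 * ((Fintype.card α).choose s : ℝ) <
      Real.exp (s.choose l / (2 * r.choose l ^ 2) * Real.log 2 -
        r.choose l * s.choose l / (Fintype.card α).choose l * T)) :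
    ∃ F : Finset (Finset α), IsPacking r l F ∧ #F ≤ T ∧
      ∀ S : Finset α, #S = s → ¬ IsIndependent F S := by
  have hchoose (m : ℕ) : (m.choose r * r.choose l : ℝ) = m.choose l * (m - l).choose (r - l) := by
    exact_mod_cast Nat.choose_mul hlr
  have hrl : (0 : ℝ) < r.choose l := by exact_mod_cast Nat.choose_pos hlr
  have hnl : (0 : ℝ) < (Fintype.card α).choose l := by
    exact_mod_cast Nat.choose_pos (hlr.trans hr)
  have hnr : (0 : ℝ) < (Fintype.card α).choose r := by exact_mod_cast Nat.choose_pos hr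
  refine exists_isPacking_of_potential_lt hlr hr (le_of_eq ?_) (le_of_eq ?_) hq hρ
  · have hhalf : (s.choose l * (s - l).choose (r - l) : ℝ) / (2 * r.choose l) =
        s.choose r / 2 := by
      rw [← hchoose]
      field_simp
    calc _ = (s.choose r / 2 : ℝ) +
            s.choose l * (s - l).choose (r - l) / (2 * r.choose l) := by field_simp
      _ = s.choose r := by rw [hhalf, add_halves]
  · rw [div_mul_eq_mul_div, eq_div_iff hnl.ne']
    linear_combination -(s.choose l : ℝ) * hchoose (Fintype.card α)

end Greedy

section Chromatic

theorem lt_chromaticNumber_of_forall_card_eq {α : Type*} {H : Hypergraph α} {V : Finset α}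
    {k s : ℕ} (hk : 0 < k) (hV : ∀ x ∈ V, x ∈ H.vertexSet) (hcard : k * s ≤ V.card)
    (hH : ∀ S ⊆ V, S.card = s → ∃ e ∈ H.edgeSet, e ⊆ S) : (k : ℕ∞) < H.chromaticNumber := by
  refine lt_of_lt_of_le (b := ((k + 1 : ℕ) : ℕ∞)) (by exact_mod_cast k.lt_succ_self)
    (le_iInf₂ fun m ⟨c, hc, hce⟩ => ?_)
  by_contra! hlt
  have hmk : m ≤ k := Nat.lt_succ_iff.1 (by exact_mod_cast hlt)
  obtain ⟨i, -, hi⟩ := Finset.exists_le_card_fiber_of_mul_le_card_of_maps_to (f := c)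
    (fun x hx => Finset.mem_range.2 ((hc x (hV x hx)).trans_le hmk))
    (Finset.nonempty_range_iff.2 hk.ne') (by rwa [Finset.card_range])
  obtain ⟨S, hSi, hS⟩ := Finset.exists_subset_card_eq hi
  obtain ⟨e, he, heS⟩ := hH S (hSi.trans (Finset.filter_subset _ _)) hS
  obtain ⟨x, hx, y, hy, hxy⟩ := hce e he
  have hcolour (z : α) (hz : z ∈ e) : c z = i := (Finset.mem_filter.1 (hSi (heS hz))).2
  exact hxy ((hcolour x hx).trans (hcolour y hy).symm)

/-- The hypergraph with edge family `F` in which every element of the type is a vertex. -/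
def finsetHypergraph {α : Type*} (F : Finset (Finset α)) : Hypergraph α where
  vertexSet := Set.univ
  edgeSet := (↑) '' (F : Set (Finset α))
  subset_vertexSet_of_mem_edgeSet' _ _ := Set.subset_univ _

theorem encard_edgeSet_finsetHypergraph {α : Type*} (F : Finset (Finset α)) :
    (finsetHypergraph F).edgeSet.encard = F.card :=
  (Finset.coe_injective.encard_image _).trans (Set.encard_coe_eq_coe_finsetCard F)

theorem IsPacking.isSystem_finsetHypergraph {α : Type*} [DecidableEq α] {r l : ℕ}
    {F : Finset (Finset α)} (hF : IsPacking r l F) : (finsetHypergraph F).IsSystem r l := by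
  refine ⟨?_, ?_⟩
  · rintro _ ⟨f, hf, rfl⟩
    rw [Set.encard_coe_eq_coe_finsetCard, hF.sized hf]
  · rintro _ ⟨f, hf, rfl⟩ _ ⟨g, hg, rfl⟩ hfg
    rw [← Finset.coe_inter, Set.encard_coe_eq_coe_finsetCard]
    exact_mod_cast hF.pairwise hf hg fun h => hfg (by rw [h])

theorem IsPacking.card_mem_systemSizes {α : Type} [DecidableEq α] [Fintype α] {r l k s : ℕ}
    {F : Finset (Finset α)} (hF : IsPacking r l F) (hk : 0 < k) (hcard : k * s ≤ Fintype.card α)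
    (hFs : ∀ S : Finset α, S.card = s → ¬ IsIndependent F S) : F.card ∈ systemSizes r l k := by
  refine ⟨α, finsetHypergraph F, Set.toFinite _, hF.isSystem_finsetHypergraph,
    lt_chromaticNumber_of_forall_card_eq hk (fun x _ => Set.mem_univ x) hcard fun S _ hS => ?_,
    encard_edgeSet_finsetHypergraph F⟩
  obtain ⟨f, hf, hfS⟩ : ∃ f ∈ F, f ⊆ S := by simpa [IsIndependent] using hFs S hS
  exact ⟨f, ⟨f, hf, rfl⟩, Finset.coe_subset.2 hfS⟩

end Chromatic

section Binomial

open scoped Nat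

theorem one_sub_sq_div_mul_pow_le_factorial_mul_choose (m r : ℕ) :
    (1 - r ^ 2 / m : ℝ) * m ^ r ≤ r ! * m.choose r := by
  rcases m.eq_zero_or_pos with rfl | hm
  · rcases r.eq_zero_or_pos with rfl | hr
    · simp
    · rw [Nat.cast_zero, zero_pow hr.ne', mul_zero]
      positivity
  have hm' : (0 : ℝ) < m := by exact_mod_cast hm
  rcases lt_or_ge m r with hmr | hrm
  · have hr : (1 : ℝ) ≤ r ^ 2 / m := by
      rw [one_le_div hm']
      exact_mod_cast hmr.le.trans (Nat.le_self_pow two_ne_zero r)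
    exact (mul_nonpos_of_nonpos_of_nonneg (by linarith) (by positivity)).trans (by positivity)
  have hrm' : (r : ℝ) / m ≤ 1 := (div_le_one hm').2 (by exact_mod_cast hrm)
  have hbernoulli : (1 - r ^ 2 / m : ℝ) ≤ (1 - r / m) ^ r := by
    have := one_add_mul_le_pow (a := -(r / m : ℝ)) (by linarith) r
    rw [← sub_eq_add_neg] at this
    exact this.trans_eq' (by ring)
  calc (1 - r ^ 2 / m : ℝ) * m ^ r ≤ (1 - r / m) ^ r * m ^ r := by gcongr
    _ = (m - r : ℝ) ^ r := by rw [← mul_pow]; congr 1; field_simp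
    _ ≤ ((m + 1 - r : ℕ) : ℝ) ^ r := by
        gcongr
        · exact sub_nonneg.2 (by exact_mod_cast hrm)
        · rw [Nat.cast_sub (by omega)]
          push_cast
          linarith
    _ ≤ r ! * m.choose r := by
        rw [← div_le_iff₀' (by positivity)]
        exact Nat.pow_le_choose r m

theorem four_mul_pow_le_five_mul_factorial_mul_choose {m r : ℕ} (h : 5 * r ^ 2 ≤ m) :
    4 * (m : ℝ) ^ r ≤ 5 * (r ! * m.choose r) := by
  have hr : (r ^ 2 / m : ℝ) ≤ 1 / 5 := by
    refine div_le_of_le_mul₀ (by positivity) (by norm_num) ?_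
    have : (5 * r ^ 2 : ℝ) ≤ m := by exact_mod_cast h
    linarith
  calc 4 * (m : ℝ) ^ r ≤ 5 * ((1 - r ^ 2 / m) * m ^ r) := by
        rw [← mul_assoc]
        gcongr
        linarith
    _ ≤ 5 * (r ! * m.choose r) :=
        mul_le_mul_of_nonneg_left (one_sub_sq_div_mul_pow_le_factorial_mul_choose m r)
          (by norm_num)

theorem four_mul_choose_mul_le_five_mul_pow_mul_choose {s r : ℕ} (k : ℕ) (h : 5 * r ^ 2 ≤ s) :
    4 * ((k * s).choose r : ℝ) ≤ 5 * (k ^ r * s.choose r) := by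
  have hr : (0 : ℝ) < r ! := by positivity
  have hupper := Nat.choose_le_pow_div (α := ℝ) r (k * s)
  rw [le_div_iff₀ hr] at hupper
  refine le_of_mul_le_mul_right ?_ hr
  calc 4 * ((k * s).choose r : ℝ) * r ! ≤ 4 * ((k * s : ℕ) : ℝ) ^ r := by linarith
    _ = k ^ r * (4 * s ^ r) := by push_cast; ring
    _ ≤ k ^ r * (5 * (r ! * s.choose r)) :=
        mul_le_mul_of_nonneg_left (four_mul_pow_le_five_mul_factorial_mul_choose h)
          (by positivity)
    _ = 5 * (k ^ r * s.choose r) * r ! := by ring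

theorem choose_mul_le_exp {k : ℕ} (hk : 0 < k) (s : ℕ) :
    ((k * s).choose s : ℝ) ≤ Real.exp (s * Real.log k + s) := by
  calc ((k * s).choose s : ℝ) ≤ ((k * s : ℕ) : ℝ) ^ s / s ! := Nat.choose_le_pow_div s (k * s)
    _ = k ^ s * (s ^ s / s !) := by push_cast; ring
    _ ≤ k ^ s * Real.exp s := by
        gcongr
        exact Real.pow_div_factorial_le_exp s s.cast_nonneg s
    _ = Real.exp (s * Real.log k + s) := by
        rw [Real.exp_add, Real.exp_nat_mul, Real.exp_log (by exact_mod_cast hk)]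

theorem two_mul_choose_mul_lt_exp {k : ℕ} (hk : 0 < k) (s : ℕ) :
    2 * ((k * s).choose s : ℝ) < Real.exp (s * Real.log k + s + 1) := by
  have he : 2 < Real.exp 1 := by linarith [Real.exp_one_gt_d9]
  calc 2 * ((k * s).choose s : ℝ) ≤ 2 * Real.exp (s * Real.log k + s) := by
        gcongr
        exact choose_mul_le_exp hk s
    _ < Real.exp 1 * Real.exp (s * Real.log k + s) := by gcongr
    _ = Real.exp (s * Real.log k + s + 1) := by rw [← Real.exp_add, add_comm 1]

theorem choose_le_three_mul_div_pow {r l : ℕ} (hl : 2 ≤ l) (hlr : l ≤ r) :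
    (r.choose l : ℝ) ≤ (3 * ((r : ℝ) - 1) / ((l : ℝ) - 1)) ^ l := by
  have hl' : (2 : ℝ) ≤ l := by exact_mod_cast hl
  have hlr' : (l : ℝ) ≤ r := by exact_mod_cast hlr
  have hratio : (r : ℝ) / l ≤ (r - 1) / (l - 1) := by
    rw [div_le_div_iff₀ (by linarith) (by linarith)]
    linarith
  have hexp : Real.exp l ≤ 3 ^ l := by
    rw [← mul_one (l : ℝ), Real.exp_nat_mul]
    gcongr
    linarith [Real.exp_one_lt_d9]
  calc (r.choose l : ℝ) ≤ r ^ l / l ! := Nat.choose_le_pow_div l r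
    _ = (r / l : ℝ) ^ l * (l ^ l / l !) := by rw [div_pow]; field_simp
    _ ≤ ((r - 1) / (l - 1) : ℝ) ^ l * 3 ^ l := by
        gcongr
        · exact pow_nonneg (div_nonneg (by linarith) (by linarith)) l
        · exact (Real.pow_div_factorial_le_exp l l.cast_nonneg l).trans hexp
    _ = (3 * ((r : ℝ) - 1) / ((l : ℝ) - 1)) ^ l := by rw [← mul_pow]; ring

end Binomial

section Parameters

open scoped Nat

theorem mul_log_add_le_choose_div_mul {r k s : ℕ} {t : ℝ} (hk : 11 ≤ Real.log k) (hs : 0 < s)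
    (hrs : 5 * r ^ 2 ≤ s) (ht : 3 * (k ^ r * s * Real.log k) ≤ t) :
    s * Real.log k + s + 1 ≤ s.choose r / (2 * (k * s).choose r) * t := by
  have hs' : (1 : ℝ) ≤ s := by exact_mod_cast hs
  have hk0 : 0 < k := Nat.pos_of_ne_zero fun h => by norm_num [h] at hk
  have hr : r ≤ s := by nlinarith [sq_nonneg r]
  have hn : (0 : ℝ) < (k * s).choose r := by
    exact_mod_cast Nat.choose_pos (hr.trans (Nat.le_mul_of_pos_left s hk0))
  have hslog : (s : ℝ) * 11 ≤ s * Real.log k := mul_le_mul_of_nonneg_left hk s.cast_nonneg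
  calc s * Real.log k + s + 1 ≤ 6 / 5 * (s * Real.log k) := by linarith
    _ = 4 * (k * s).choose r * (3 / 10 * (s * Real.log k)) / (k * s).choose r := by
        field_simp
        norm_num
    _ ≤ 5 * (k ^ r * s.choose r) * (3 / 10 * (s * Real.log k)) / (k * s).choose r := by
        gcongr ?_ * _ / _
        exact four_mul_choose_mul_le_five_mul_pow_mul_choose k hrs
    _ = s.choose r / (2 * (k * s).choose r) * (3 * (k ^ r * s * Real.log k)) := by
        field_simp
        ring
    _ ≤ s.choose r / (2 * (k * s).choose r) * t := by gcongr

theorem mul_log_add_le_choose_div {l k s : ℕ} {c : ℝ} (hl : 2 ≤ l) (hc : 0 < c) (hs : 0 < s)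
    (hls : 5 * l ^ 2 ≤ s) (hsc : 5 * c * l ! * (Real.log k + 2) ≤ 4 * s) :
    s * Real.log k + s + 1 ≤ s.choose l / c := by
  have hs' : (1 : ℝ) ≤ s := by exact_mod_cast hs
  rw [le_div_iff₀ hc]
  refine le_of_mul_le_mul_left ?_ (by positivity : (0 : ℝ) < 5 * l !)
  calc 5 * l ! * ((s * Real.log k + s + 1) * c) ≤ 5 * l ! * ((s * (Real.log k + 2)) * c) := by
        gcongr
        linarith
    _ = 5 * c * l ! * (Real.log k + 2) * s := by ring
    _ ≤ 4 * s * s := by gcongr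
    _ = 4 * (s : ℝ) ^ 2 := by ring
    _ ≤ 4 * (s : ℝ) ^ l := by gcongr
    _ ≤ 5 * l ! * s.choose l := by
        rw [mul_assoc 5]
        exact four_mul_pow_le_five_mul_factorial_mul_choose hls

theorem mul_le_choose_of_mul_le_pow {l n : ℕ} {t : ℝ} (hl : 0 < l) (hln : 5 * l ^ 2 ≤ n)
    (ht : 5 * l ! * t ≤ 4 * (n : ℝ) ^ (l - 1)) : n * t ≤ n.choose l := by
  refine le_of_mul_le_mul_left ?_ (by positivity : (0 : ℝ) < 5 * l !)
  calc 5 * l ! * (n * t) = 5 * l ! * t * n := by ring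
    _ ≤ 4 * (n : ℝ) ^ (l - 1) * n := by gcongr
    _ = 4 * (n : ℝ) ^ l := by rw [mul_assoc, pow_sub_one_mul hl.ne']
    _ ≤ 5 * l ! * n.choose l := by
        rw [mul_assoc 5]
        exact four_mul_pow_le_five_mul_factorial_mul_choose hln

theorem choose_mul_choose_div_choose_mul_le {r l s n : ℕ} {t u : ℝ} (hlr : l ≤ r) (hu : 0 < u)
    (htu : t ≤ 4 * u) (hn : 32 * (r.choose l : ℝ) ^ 3 * u ≤ n.choose l) :
    r.choose l * s.choose l / n.choose l * t ≤ s.choose l / (8 * r.choose l ^ 2) := by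
  have hR : (0 : ℝ) < r.choose l := by exact_mod_cast Nat.choose_pos hlr
  calc (r.choose l * s.choose l / n.choose l * t : ℝ)
      ≤ r.choose l * s.choose l / n.choose l * (4 * u) := by gcongr
    _ ≤ r.choose l * s.choose l / (32 * r.choose l ^ 3 * u) * (4 * u) := by gcongr
    _ = s.choose l / (8 * r.choose l ^ 2) := by
        field_simp
        ring

theorem le_div_mul_log_two_sub {a c x y : ℝ} (ha : 0 ≤ a) (hc : 0 ≤ c) (hx : x ≤ a / (8 * c))
    (hy : y ≤ a / (8 * c)) : x ≤ a / (2 * c) * Real.log 2 - y := by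
  have hlog : a / (8 * c) * 2 ≤ a / (8 * c) * (4 * Real.log 2) := by
    gcongr
    linarith [Real.log_two_gt_d9]
  have hquarter : a / (2 * c) = a / (8 * c) * 4 := by
    rw [div_mul_eq_mul_div, mul_comm a, show 8 * c = 4 * (2 * c) by ring,
      mul_div_mul_left _ _ four_ne_zero]
  rw [hquarter]
  linarith

theorem exists_isPacking_card_le {r l k s : ℕ} (hl : 2 ≤ l) (hlr : l ≤ r)
    (hk : 11 ≤ Real.log k) (hrs : 5 * r ^ 2 ≤ s)
    (hs : 10 * l ! * (r.choose l : ℝ) ^ 2 * (Real.log k + 2) ≤ s)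
    (hn : 40 * l ! * (r.choose l : ℝ) ^ 3 * (k ^ (r - 1) * Real.log k) ≤
      ((k * s : ℕ) : ℝ) ^ (l - 1)) :
    ∃ F : Finset (Finset (Fin (k * s))), IsPacking r l F ∧
      F.card ≤ 4 * ((k * s : ℕ) * (k ^ (r - 1) * Real.log k)) ∧
      ∀ S : Finset (Fin (k * s)), S.card = s → ¬ IsIndependent F S := by
  have hk0 : 0 < k := Nat.pos_of_ne_zero fun h => by norm_num [h] at hk
  have hs0 : 0 < s := by nlinarith
  have hsn : s ≤ k * s := Nat.le_mul_of_pos_left s hk0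
  have hls : 5 * l ^ 2 ≤ s := hrs.trans' (by gcongr)
  have hR : (0 : ℝ) < r.choose l := by exact_mod_cast Nat.choose_pos hlr
  set n := k * s
  set L : ℝ := k ^ (r - 1) * Real.log k
  have hL : 1 ≤ L := one_le_mul_of_one_le_of_one_le
    (one_le_pow₀ (by exact_mod_cast hk0)) (by linarith)
  have hnL : 1 ≤ n * L := one_le_mul_of_one_le_of_one_le
    (by exact_mod_cast hs0.trans_le hsn) hL
  have hT : (⌈3 * (n * L)⌉₊ : ℝ) ≤ 4 * (n * L) := by
    linarith [Nat.ceil_lt_add_one (a := 3 * (n * L)) (by linarith)]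
  -- A quarter of the threshold on the number of conflicts.
  set A : ℝ := s.choose l / (8 * r.choose l ^ 2)
  have hA : s * Real.log k + s + 1 ≤ A :=
    mul_log_add_le_choose_div hl (by positivity) hs0 hls (by linarith)
  have hconflicts : r.choose l * s.choose l / n.choose l * ⌈3 * (n * L)⌉₊ ≤ A := by
    refine choose_mul_choose_div_choose_mul_le hlr (by linarith) hT ?_
    rw [mul_left_comm]
    exact mul_le_choose_of_mul_le_pow (by omega) (hls.trans hsn) (by linarith)
  obtain ⟨F, hF, hFT, hFS⟩ := exists_isPacking_of_two_mul_choose_lt_exp (α := Fin n) (s := s)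
    (T := ⌈3 * (n * L)⌉₊) hlr (by rw [Fintype.card_fin]; nlinarith)
    (by
      rw [Fintype.card_fin]
      refine (two_mul_choose_mul_lt_exp hk0 s).trans_le (Real.exp_le_exp.2 ?_)
      refine mul_log_add_le_choose_div_mul hk hs0 hrs ((Nat.le_ceil _).trans' (le_of_eq ?_))
      rw [← pow_sub_one_mul (by omega : r ≠ 0) (k : ℝ)]
      simp only [n, L]
      push_cast
      ring)
    (by
      rw [Fintype.card_fin]
      refine (two_mul_choose_mul_lt_exp hk0 s).trans_le (Real.exp_le_exp.2 ?_)
      exact le_div_mul_log_two_sub (by positivity) (by positivity) hA hconflicts)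
  exact ⟨F, hF, hT.trans' (by exact_mod_cast hFT), hFS⟩

theorem lt_systemConst {r l : ℕ} (hl : 2 ≤ l) (hlr : l ≤ r) :
    6 * (40 * l ! * (r.choose l : ℝ) ^ 3) ^ (1 / ((l : ℝ) - 1)) < systemConst r l := by
  have hl' : (2 : ℝ) ≤ l := by exact_mod_cast hl
  have hlr' : (l : ℝ) ≤ r := by exact_mod_cast hlr
  have hR : (0 : ℝ) < r.choose l := by exact_mod_cast Nat.choose_pos hlr
  have hdesc : 100 * (r.descFactorial l : ℝ) ^ 2 / l ! = 100 * l ! * (r.choose l : ℝ) ^ 2 := by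
    rw [Nat.descFactorial_eq_factorial_mul_choose]
    push_cast
    field_simp
  have hexponent : (l : ℝ) / (l - 1) = l * (1 / (l - 1)) := by ring
  have hp : 0 < 1 / ((l : ℝ) - 1) := one_div_pos.2 (by linarith)
  have hlp : 1 ≤ (l : ℝ) * (1 / (l - 1)) := by
    rw [← hexponent, one_le_div (by linarith)]
    linarith
  rw [systemConst, hdesc, hexponent]
  set p := 1 / ((l : ℝ) - 1)
  have hratio : 0 ≤ 3 * ((r : ℝ) - 1) / (l - 1) := div_nonneg (by linarith) (by linarith)
  have hchoose : 10 / 3 * (r.choose l : ℝ) ^ p ≤ (10 * ((r : ℝ) - 1) / (l - 1)) ^ (l * p) := by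
    calc 10 / 3 * (r.choose l : ℝ) ^ p
        ≤ (10 / 3) ^ (l * p) * ((3 * ((r : ℝ) - 1) / (l - 1)) ^ l) ^ p := by
          gcongr
          · exact Real.self_le_rpow_of_one_le (by norm_num) hlp
          · exact choose_le_three_mul_div_pow hl hlr
      _ = (10 * ((r : ℝ) - 1) / (l - 1)) ^ (l * p) := by
          rw [← Real.rpow_natCast, ← Real.rpow_mul hratio, ← Real.mul_rpow (by norm_num) hratio]
          congr 1
          ring
  calc 6 * (40 * l ! * (r.choose l : ℝ) ^ 3) ^ p
      < 20 / 3 * (100 * l ! * (r.choose l : ℝ) ^ 3) ^ p := by gcongr <;> norm_num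
    _ = 2 * (100 * l ! * (r.choose l : ℝ) ^ 2) ^ p * (10 / 3 * (r.choose l : ℝ) ^ p) := by
        rw [pow_succ _ 2, ← mul_assoc, Real.mul_rpow (by positivity) hR.le]
        ring
    _ ≤ _ := by gcongr

theorem eventually_mul_log_add_le_rpow (C D : ℝ) {p : ℝ} (hp : 0 < p) :
    ∀ᶠ k : ℕ in atTop, C * Real.log k + D ≤ (k : ℝ) ^ p := by
  have hlog : ∀ᶠ x : ℝ in atTop, C * Real.log x ≤ 1 / 2 * x ^ p := by
    filter_upwards [((isLittleO_log_rpow_atTop hp).const_mul_left C).bound one_half_pos,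
      eventually_ge_atTop 0] with x hx hx0
    rw [Real.norm_of_nonneg (Real.rpow_nonneg hx0 p)] at hx
    exact (le_abs_self _).trans hx
  have hconst := (tendsto_rpow_atTop hp).eventually_ge_atTop (2 * D)
  filter_upwards [tendsto_natCast_atTop_atTop.eventually (hlog.and hconst)] with k hk
  linarith [hk.1, hk.2]

theorem rpow_le_rpow_div_of_pow_le {l : ℕ} (hl : 2 ≤ l) {x y : ℝ} (hx : 0 < x)
    (hxy : x ^ l ≤ y) : x ^ (1 / ((l : ℝ) - 1)) ≤ y ^ (1 / ((l : ℝ) - 1)) / x := by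
  have hl' : (2 : ℝ) ≤ l := by exact_mod_cast hl
  rw [le_div_iff₀ hx]
  calc x ^ (1 / ((l : ℝ) - 1)) * x = (x ^ l) ^ (1 / ((l : ℝ) - 1)) := by
        rw [← Real.rpow_add_one hx.ne', ← Real.rpow_natCast, ← Real.rpow_mul hx.le]
        congr 1
        have : (l : ℝ) - 1 ≠ 0 := by linarith
        field_simp
        ring
    _ ≤ y ^ (1 / ((l : ℝ) - 1)) := by
        gcongr
        exact one_div_nonneg.2 (by linarith)

-- `s` is the least integer for which the second inequality holds; the first one says that this
-- `s` is large, which is where the exponent `r - 1 ≥ l` enters.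
theorem eventually_exists_blockSize {r l : ℕ} (hl : 2 ≤ l) (hlr : l < r) {B : ℝ} (hB : 1 ≤ B)
    (C D : ℝ) : ∀ᶠ k : ℕ in atTop, ∃ s : ℕ, C * Real.log k + D ≤ s ∧
      B * (k ^ (r - 1) * Real.log k) ≤ ((k * s : ℕ) : ℝ) ^ (l - 1) ∧
      k * s ≤ 3 / 2 * (B * (k ^ (r - 1) * Real.log k)) ^ (1 / ((l : ℝ) - 1)) := by
  have hl' : (2 : ℝ) ≤ l := by exact_mod_cast hl
  have hp : 0 < 1 / ((l : ℝ) - 1) := one_div_pos.2 (by linarith)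
  filter_upwards [eventually_mul_log_add_le_rpow C D hp, eventually_mul_log_add_le_rpow 0 2 hp,
    (Real.tendsto_log_atTop.comp tendsto_natCast_atTop_atTop).eventually_ge_atTop 1,
    eventually_gt_atTop 0] with k hCD htwo hlog hk
  have hk' : (0 : ℝ) < k := by exact_mod_cast hk
  set y : ℝ := B * (k ^ (r - 1) * Real.log k)
  have hky : (k : ℝ) ^ l ≤ y := by
    calc (k : ℝ) ^ l ≤ k ^ (r - 1) := pow_le_pow_right₀ (by exact_mod_cast hk) (by omega)
      _ ≤ k ^ (r - 1) * Real.log k := le_mul_of_one_le_right (by positivity) hlog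
      _ ≤ y := le_mul_of_one_le_left (by positivity) hB
  have hy : 0 < y := hky.trans_lt' (by positivity)
  have hX := rpow_le_rpow_div_of_pow_le hl hk' hky
  set X : ℝ := y ^ (1 / ((l : ℝ) - 1)) / k
  have hkX : k * X = y ^ (1 / ((l : ℝ) - 1)) := mul_div_cancel₀ _ hk'.ne'
  have hXs : X ≤ ⌈X⌉₊ := Nat.le_ceil X
  refine ⟨⌈X⌉₊, hCD.trans (hX.trans hXs), ?_, ?_⟩
  · calc y = (k * X) ^ (l - 1) := by
          rw [hkX, ← Real.rpow_natCast, ← Real.rpow_mul hy.le, Nat.cast_pred (by omega),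
            one_div_mul_cancel (by linarith), Real.rpow_one]
      _ ≤ ((k * ⌈X⌉₊ : ℕ) : ℝ) ^ (l - 1) := by
          push_cast
          gcongr
  · calc (k * ⌈X⌉₊ : ℝ) ≤ k * (3 / 2 * X) := by
          gcongr
          linarith [Nat.ceil_lt_add_one (a := X) (by linarith)]
      _ = 3 / 2 * y ^ (1 / ((l : ℝ) - 1)) := by rw [mul_left_comm, hkX]

theorem eventually_exists_mem_systemSizes_lt {r l : ℕ} (hl : 2 ≤ l) (hlr : l < r) :
    ∀ᶠ k : ℕ in atTop, ∃ m ∈ systemSizes r l k, (m : ℝ) < systemConst r l *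
      ((k : ℝ) ^ (r - 1) * Real.log k) ^ ((l : ℝ) / ((l : ℝ) - 1)) := by
  have hl' : (2 : ℝ) ≤ l := by exact_mod_cast hl
  set B : ℝ := 40 * l ! * (r.choose l : ℝ) ^ 3
  have hB : 1 ≤ B := by
    have hR : 0 < r.choose l := Nat.choose_pos hlr.le
    have hpos : 1 ≤ 40 * l ! * r.choose l ^ 3 := Nat.succ_le_of_lt (by positivity)
    simp only [B]
    exact_mod_cast hpos
  set C : ℝ := 10 * l ! * (r.choose l : ℝ) ^ 2
  have hC : 0 ≤ C := by positivity
  filter_upwards [eventually_exists_blockSize hl hlr hB C (2 * C + 5 * r ^ 2),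
    (Real.tendsto_log_atTop.comp tendsto_natCast_atTop_atTop).eventually_ge_atTop 11]
    with k ⟨s, hs, hpow, hks⟩ (hlog : 11 ≤ Real.log k)
  have hk : 0 < k := Nat.pos_of_ne_zero fun h => by norm_num [h] at hlog
  set L : ℝ := k ^ (r - 1) * Real.log k
  have hL : 0 < L := by positivity
  have hClog : 0 ≤ C * Real.log k := by positivity
  have hrs : 5 * r ^ 2 ≤ s := by
    have : (5 * r ^ 2 : ℝ) ≤ s := by linarith
    exact_mod_cast this
  have hCs : C * (Real.log k + 2) ≤ s := by linarith [sq_nonneg (r : ℝ)]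
  obtain ⟨F, hF, hFcard, hFs⟩ := exists_isPacking_card_le hl hlr.le hlog hrs hCs hpow
  refine ⟨F.card, hF.card_mem_systemSizes hk (Fintype.card_fin _).ge hFs, ?_⟩
  calc (F.card : ℝ) ≤ 4 * ((k * s) * L) := by rwa [Nat.cast_mul] at hFcard
    _ ≤ 4 * (3 / 2 * (B * L) ^ (1 / ((l : ℝ) - 1)) * L) := by gcongr
    _ = 6 * B ^ (1 / ((l : ℝ) - 1)) * (L ^ (1 / ((l : ℝ) - 1)) * L) := by
        rw [Real.mul_rpow (by positivity) hL.le]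
        ring
    _ < systemConst r l * (L ^ (1 / ((l : ℝ) - 1)) * L) := by
        gcongr
        exact lt_systemConst hl hlr.le
    _ = systemConst r l * L ^ ((l : ℝ) / ((l : ℝ) - 1)) := by
        rw [← Real.rpow_add_one hL.ne']
        congr 2
        have : (l : ℝ) - 1 ≠ 0 := by linarith
        field_simp
        ring

end Parameters

theorem theorem3 (r l : ℕ) (hl : 2 ≤ l) (hlr : l < r) :
    ∀ᶠ k : ℕ in atTop, ∃ m : ℕ, IsLeast (systemSizes r l k) m ∧
      (m : ℝ) < systemConst r l *
        ((k : ℝ) ^ (r - 1) * Real.log k) ^ ((l : ℝ) / ((l : ℝ) - 1)) := by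
  filter_upwards [eventually_exists_mem_systemSizes_lt hl hlr] with k ⟨m, hm, hmlt⟩
  refine ⟨sInf (systemSizes r l k), ⟨Nat.sInf_mem ⟨m, hm⟩, fun _ h => Nat.sInf_le h⟩, ?_⟩
  exact hmlt.trans_le' (by exact_mod_cast Nat.sInf_le hm)
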